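/- **Model.** Let $n\ge 2$ and let matrix entries be represented by the elements of an additive abelian group $G$ (for instance bit strings with bitwise XOR, or $\mathbb C$ itself), where $g\in G$ represents the number $\mathrm{val}(g)\in\mathbb C$; the numbers $0$ and $1$ are assumed to be representable. The entry oracle of a pair of $n\times n$ matrices $A=(\mathrm{val}(X^A_{ij}))$, $B=(\mathrm{val}(X^B_{ij}))$ is the unitary $$|M,s,i,j,z\rangle\mapsto|M,s,i,j,z+s\,X^M_{ij}\rangle,\qquad M\in\{A,B\},\ s\in\{1,-1,0\},\ i,j\in[n],\ z\in G,$$ so that in particular $|i,j\rangle|0\rangle\mapsto|i,j\rangle|M_{ij}\rangle$, and inverse and controlled queries are allowed. A quantum algorithm making $T$ queries starts from $|\psi\rangle^{\otimes k}$, for any finite number $k$ of copies, together with a fixed basis state of the query register and of an arbitrarily large work register; it applies $U_T\,O\,U_{T-1}\,O\cdots O\,U_0$, where $O$ is the oracle and $U_0,\dots,U_T$ are arbitrary unitaries on the whole memory that do not depend on $A,B$; it then measures in the standard basis and outputs a complex number determined by the outcome. **Theorem.** There is an absolute constant $c>0$ such that for every $n\ge 2$ there is a unit vector $|\psi\rangle\in\mathbb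 C^n$ with the following property. Let $0\le\varepsilon<1/2$, and consider any quantum algorithm of the above kind, over any representation of the entries, which, given copies of $|\psi\rangle$ and query access to the entries of $n\times n$ matrices $A$ and $B$, outputs with probability at least $2/3$ a number within $\varepsilon$ of some $\lambda\in\mathbb C$ satisfying $A|\psi\rangle=\lambda B|\psi\rangle$, whenever $A,B$ have representable entries, $B$ is singular and such a $\lambda$ exists. Then the algorithm makes at least $c\sqrt n$ queries to $A$ and $B$. In particular ($\varepsilon=0$), given copies of a state $|\psi\rangle$ and query access to the entries of $A$ and $B$ with the promise that $A|\psi\rangle=\lambda B|\psi\rangle$ and $B$ is singular, finding $\lambda$ requires $\Omega(\sqrt n)$ quantum queries. -/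

import Mathlib

open scoped Matrix lp

universe u v

noncomputable section

namespace SingularGEP

theorem memℓp_comp_equiv {ι : Type*} (e : ι ≃ ι) (f : ℓ²(ι, ℂ)) :
    Memℓp (fun x => f (e x)) 2 := by
  have h := lp.memℓp f
  rw [memℓp_gen_iff (by norm_num)] at h ⊢
  exact (e.summable_iff (f := fun i => ‖f i‖ ^ (2 : ENNReal).toReal)).2 h

/-- The unitary of `ℓ²(ι)` permuting the standard basis by `|x⟩ ↦ |e x⟩`. -/
def permUnitary {ι : Type*} (e : ι ≃ ι) : ℓ²(ι, ℂ) ≃ₗᵢ[ℂ] ℓ²(ι, ℂ) where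
  toFun f := ⟨fun x => f (e.symm x), memℓp_comp_equiv e.symm f⟩
  invFun f := ⟨fun x => f (e x), memℓp_comp_equiv e f⟩
  left_inv f := by ext x; simp
  right_inv f := by ext x; simp
  map_add' f g := rfl
  map_smul' a f := rfl
  norm_map' f := by
    rw [lp.norm_eq_tsum_rpow (by norm_num), lp.norm_eq_tsum_rpow (by norm_num)]
    congr 1
    exact e.symm.tsum_eq (fun i => ‖f i‖ ^ (2 : ENNReal).toReal)

/-- Classical contents `(b, s, i, j, z)` of the query register: `b` selects one of the two
matrices (`false` for `A`, `true` for `B`), `s ∈ {1, -1, 0}` says whether the query is a forward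
one, an inverse one, or is skipped (so that inverse and controlled queries are available),
`(i, j)` is the queried position, and `z` is the register that receives the entry. Entries are
represented by elements of an additive commutative group `G`, such as bit strings with
bitwise XOR, or `ℂ` itself. -/
abbrev QueryReg (n : ℕ) (G : Type u) : Type u :=
  Bool × SignType × Fin n × Fin n × G

/-- The basis permutation `|b, s, i, j, z⟩|r⟩ ↦ |b, s, i, j, z + s • (X b)ᵢⱼ⟩|r⟩`. -/
def oraclePerm {n : ℕ} {G : Type u} [AddCommGroup G] {R : Type*}
    (X : Bool → Matrix (Fin n) (Fin n) G) : QueryReg n G × R ≃ QueryReg n G × R where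
  toFun := fun ((b, s, i, j, z), r) => ((b, s, i, j, z + (s : ℤ) • X b i j), r)
  invFun := fun ((b, s, i, j, z), r) => ((b, s, i, j, z - (s : ℤ) • X b i j), r)
  left_inv := by rintro ⟨⟨b, s, i, j, z⟩, r⟩; simp
  right_inv := by rintro ⟨⟨b, s, i, j, z⟩, r⟩; simp

/-- The entry oracle of the pair of (represented) matrices `X false`, `X true`. In particular
`|b, 1, i, j, 0⟩ ↦ |b, 1, i, j, (X b)ᵢⱼ⟩`. -/
def oracle {n : ℕ} {G : Type u} [AddCommGroup G] {R : Type*}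
    (X : Bool → Matrix (Fin n) (Fin n) G) :
    ℓ²(QueryReg n G × R, ℂ) ≃ₗᵢ[ℂ] ℓ²(QueryReg n G × R, ℂ) :=
  permUnitary (oraclePerm X)

/-- A quantum query algorithm that receives `copies` copies of a state in `ℂⁿ`. Its memory
consists of the query register, the registers holding the copies, and a work register with
an arbitrary set `Work` of basis states. Starting with the query and work registers in the
basis state `start`, it applies `U 0`, then alternates `queries` many oracle calls with the
input-independent unitaries `U 1, …, U queries` of the whole memory, finally measures the memory
in the standard basis, and outputs the number `out x` if the outcome is `x`. -/
structure QueryAlgorithm (n : ℕ) (G : Type u) where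
  copies : ℕ
  queries : ℕ
  Work : Type v
  start : QueryReg n G × Work
  U : ℕ → (ℓ²(QueryReg n G × (Fin copies → Fin n) × Work, ℂ) ≃ₗᵢ[ℂ]
    ℓ²(QueryReg n G × (Fin copies → Fin n) × Work, ℂ))
  out : QueryReg n G × (Fin copies → Fin n) × Work → ℂ

namespace QueryAlgorithm

variable {n : ℕ} {G : Type u}

/-- The basis states of the whole memory. -/
abbrev Basis (alg : QueryAlgorithm.{u, v} n G) : Type (max u v) :=
  QueryReg n G × (Fin alg.copies → Fin n) × alg.Work

open Classical in
/-- The initial state `|start⟩ ⊗ ψ^{⊗ copies}`. -/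
def init (alg : QueryAlgorithm.{u, v} n G) (ψ : EuclideanSpace ℂ (Fin n)) :
    ℓ²(alg.Basis, ℂ) :=
  ∑ y : Fin alg.copies → Fin n,
    (∏ l, ψ (y l)) • lp.single 2 ((alg.start.1, y, alg.start.2) : alg.Basis) (1 : ℂ)

/-- The state of the memory after `t` queries (and the unitary following the last of them). -/
def state [AddCommGroup G] (alg : QueryAlgorithm.{u, v} n G)
    (X : Bool → Matrix (Fin n) (Fin n) G) (ψ : EuclideanSpace ℂ (Fin n)) :
    ℕ → ℓ²(alg.Basis, ℂ)
  | 0 => alg.U 0 (alg.init ψ)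
  | t + 1 => alg.U (t + 1) (oracle X (alg.state X ψ t))

/-- The probability that the output lies in `S`, on input the entry oracle of `X` and copies
of `ψ`. -/
def outputProb [AddCommGroup G] (alg : QueryAlgorithm.{u, v} n G)
    (X : Bool → Matrix (Fin n) (Fin n) G) (ψ : EuclideanSpace ℂ (Fin n)) (S : Set ℂ) : ℝ :=
  ∑' x : alg.Basis, (alg.out ⁻¹' S).indicator (fun x => ‖alg.state X ψ alg.queries x‖ ^ 2) x

/-- With the group elements `g` representing the numbers `val g`: whenever `A ψ = λ B ψ` for
some `λ ∈ ℂ`, and `B` is singular, the algorithm, given copies of `ψ` and query access to the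
entries of `A` and `B`, outputs such a `λ`, up to an error of at most `ε`, with
probability at least `2/3`. -/
def FindsEigenvalue [AddCommGroup G] (alg : QueryAlgorithm.{u, v} n G) (val : G → ℂ)
    (ψ : EuclideanSpace ℂ (Fin n)) (ε : ℝ) : Prop :=
  ∀ X : Bool → Matrix (Fin n) (Fin n) G, ∀ A B : Matrix (Fin n) (Fin n) ℂ,
    A = (X false).map val → B = (X true).map val →
    B.det = 0 → (∃ μ : ℂ, A *ᵥ ψ.ofLp = μ • (B *ᵥ ψ.ofLp)) →
    2 / 3 ≤ alg.outputProb X ψ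
      {z : ℂ | ∃ μ : ℂ, A *ᵥ ψ.ofLp = μ • (B *ᵥ ψ.ofLp) ∧ ‖z - μ‖ ≤ ε}

end QueryAlgorithm

end SingularGEP

end

namespace SingularGEP

/-! ### Mass of a vector on a set of basis states. -/

section SquareSummable

variable {ι : Type*}

/-! Take `ψ` to be a basis vector `e_{j₀}`, whose copies say nothing about the input. Put `a` in `A`
and `1` in `B` at one position `(k, j₀)`, zeros elsewhere: then `a` is the only solution `λ`, yet
`k` is unknown, so telling `a = 0` from `a = 1` is a search among `n` rows. The hybrid argument
compares both inputs with the all-zero one (`norm_state_sub_le`). On that input some row `k`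
receives total query amplitude at most `T / √n` (`exists_row_sum_sqrt_mass_le`), while success
forces the two final states a constant apart (`le_norm_state_sub_sq`). -/

theorem summable_norm_sq (f : ℓ²(ι, ℂ)) : Summable fun x => ‖f x‖ ^ 2 := by
  have h := lp.memℓp f
  rw [memℓp_gen_iff (by norm_num)] at h
  simpa using h

theorem norm_sq_eq_tsum (f : ℓ²(ι, ℂ)) : ‖f‖ ^ 2 = ∑' x, ‖f x‖ ^ 2 := by
  have h := lp.norm_rpow_eq_tsum (p := 2) (by norm_num) f
  simpa using h

/-- The squared norm of the part of `f` supported on `D`. -/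
noncomputable def mass (D : Set ι) (f : ℓ²(ι, ℂ)) : ℝ :=
  ∑' x, D.indicator (fun x => ‖f x‖ ^ 2) x

theorem summable_mass (D : Set ι) (f : ℓ²(ι, ℂ)) :
    Summable (D.indicator fun x => ‖f x‖ ^ 2) :=
  (summable_norm_sq f).indicator D

theorem mass_nonneg (D : Set ι) (f : ℓ²(ι, ℂ)) : 0 ≤ mass D f :=
  tsum_nonneg fun _ => Set.indicator_nonneg (fun _ _ => by positivity) _

theorem sum_mass_le {κ : Type*} [Fintype κ] (D : κ → Set ι)
    (hD : Pairwise fun k l => Disjoint (D k) (D l)) (f : ℓ²(ι, ℂ)) :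
    ∑ k, mass (D k) f ≤ ‖f‖ ^ 2 := by
  classical
  unfold mass
  rw [← Summable.tsum_finsetSum fun k _ => summable_mass (D k) f, norm_sq_eq_tsum]
  refine Summable.tsum_le_tsum (fun x => ?_) (summable_sum fun k _ => summable_mass (D k) f)
    (summable_norm_sq f)
  by_cases hx : ∃ k, x ∈ D k
  · obtain ⟨k, hk⟩ := hx
    rw [Finset.sum_eq_single k]
    · rw [Set.indicator_of_mem hk]
    · intro l _ hl
      exact Set.indicator_of_notMem (Set.disjoint_left.1 (hD hl.symm) hk) _
    · simp
  · push Not at hx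
    rw [Finset.sum_eq_zero fun k _ => Set.indicator_of_notMem (hx k) _]
    positivity

theorem mass_add_mass_le {S S' : Set ι} (h : Disjoint S S') (f : ℓ²(ι, ℂ)) :
    mass S f + mass S' f ≤ ‖f‖ ^ 2 := by
  have := sum_mass_le (fun b : Bool => cond b S S')
    (by rintro (_ | _) (_ | _) hb <;> simp_all [disjoint_comm]) f
  simpa using this

/-- Pointwise `(a + b)² ≤ 3/2 a² + 3 b²`. The weight `3/2` is small enough to separate success
probability `2/3` from `1/3`. -/
theorem mass_le_of_sub (S : Set ι) (f g : ℓ²(ι, ℂ)) :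
    mass S f ≤ 3 / 2 * mass S g + 3 * ‖f - g‖ ^ 2 := by
  rw [norm_sq_eq_tsum]
  unfold mass
  rw [← tsum_mul_left, ← tsum_mul_left,
    ← Summable.tsum_add ((summable_mass S g).mul_left _) ((summable_norm_sq (f - g)).mul_left _)]
  refine Summable.tsum_le_tsum (fun x => ?_) (summable_mass S f)
    (((summable_mass S g).mul_left _).add ((summable_norm_sq (f - g)).mul_left _))
  by_cases hx : x ∈ S
  · simp only [Set.indicator_of_mem hx, lp.coeFn_sub, Pi.sub_apply]
    have h : ‖f x‖ ≤ ‖g x‖ + ‖f x - g x‖ := by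
      simpa using norm_add_le (g x) (f x - g x)
    nlinarith [sq_nonneg (‖g x‖ - 2 * ‖f x - g x‖), norm_nonneg (f x), norm_nonneg (g x)]
  · simp only [Set.indicator_of_notMem hx]
    positivity

theorem permUnitary_apply (e : ι ≃ ι) (f : ℓ²(ι, ℂ)) (x : ι) :
    permUnitary e f x = f (e.symm x) := rfl

theorem mass_permUnitary (e : ι ≃ ι) (D : Set ι) (hD : ∀ x, e.symm x ∈ D ↔ x ∈ D)
    (f : ℓ²(ι, ℂ)) : mass D (permUnitary e f) = mass D f := by
  unfold mass
  rw [← e.symm.tsum_eq (D.indicator fun x => ‖f x‖ ^ 2)]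
  refine tsum_congr fun x => ?_
  classical
  simp only [Set.indicator_apply, hD, permUnitary_apply]

/-- Two basis permutations that agree off `D`, and preserve `D`, differ on `f` by at most twice
the norm of the part of `f` on `D`. -/
theorem norm_permUnitary_sub_le (e e' : ι ≃ ι) (D : Set ι)
    (he : ∀ x, e.symm x ∈ D ↔ x ∈ D) (he' : ∀ x, e'.symm x ∈ D ↔ x ∈ D)
    (hee' : ∀ x, x ∉ D → e.symm x = e'.symm x) (f : ℓ²(ι, ℂ)) :
    ‖permUnitary e f - permUnitary e' f‖ ≤ 2 * Real.sqrt (mass D f) := by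
  have key : ‖permUnitary e f - permUnitary e' f‖ ^ 2 ≤ 4 * mass D f := by
    -- Both permutations preserve the mass on `D`, so `|u - v|² ≤ 2|u|² + 2|v|²` suffices there.
    have h : 4 * mass D f = 2 * mass D (permUnitary e f) + 2 * mass D (permUnitary e' f) := by
      rw [mass_permUnitary e D he, mass_permUnitary e' D he']
      ring
    rw [h, norm_sq_eq_tsum]
    unfold mass
    have s := (summable_mass D (permUnitary e f)).mul_left 2
    have s' := (summable_mass D (permUnitary e' f)).mul_left 2
    rw [← tsum_mul_left, ← tsum_mul_left, ← Summable.tsum_add s s']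
    refine Summable.tsum_le_tsum (fun x => ?_) (summable_norm_sq _) (s.add s')
    simp only [lp.coeFn_sub, Pi.sub_apply]
    by_cases hx : x ∈ D
    · simp only [Set.indicator_of_mem hx]
      have := norm_sub_le (permUnitary e f x) (permUnitary e' f x)
      nlinarith [sq_nonneg (‖permUnitary e f x‖ - ‖permUnitary e' f x‖),
        norm_nonneg (permUnitary e f x - permUnitary e' f x)]
    · simp [Set.indicator_of_notMem hx, permUnitary_apply, hee' x hx]
  refine (pow_le_pow_iff_left₀ (by positivity) (by positivity) two_ne_zero).1 ?_
  rw [mul_pow, Real.sq_sqrt (mass_nonneg D f)]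
  linarith

end SquareSummable

/-! ### The hybrid argument. -/

namespace QueryAlgorithm

variable {n : ℕ} {G : Type u} (alg : QueryAlgorithm.{u, v} n G)

/-- The basis states whose query register points at row `k` of column `j₀`. -/
def rowSet (j₀ k : Fin n) : Set alg.Basis :=
  {x | x.1.2.2.1 = k ∧ x.1.2.2.2.1 = j₀}

theorem pairwise_disjoint_rowSet (j₀ : Fin n) :
    Pairwise fun k l => Disjoint (alg.rowSet j₀ k) (alg.rowSet j₀ l) := by
  intro k l hkl
  rw [Set.disjoint_left]
  rintro x ⟨h, -⟩ ⟨h', -⟩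
  exact hkl (h.symm.trans h')

theorem norm_init_single (j₀ : Fin n) : ‖alg.init (EuclideanSpace.single j₀ 1)‖ = 1 := by
  classical
  unfold init
  rw [Finset.sum_eq_single fun _ => j₀]
  · simp
  · intro y _ hy
    obtain ⟨l, hl⟩ := Function.ne_iff.1 hy
    rw [Finset.prod_eq_zero (Finset.mem_univ l) (by simp [hl]), zero_smul]
  · simp

variable [AddCommGroup G]

theorem norm_state (X : Bool → Matrix (Fin n) (Fin n) G) (ψ : EuclideanSpace ℂ (Fin n)) (t : ℕ) :
    ‖alg.state X ψ t‖ = ‖alg.init ψ‖ := by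
  induction t with
  | zero => simp [state]
  | succ t ih => simp [state, ih]

/-- The hybrid bound: inputs that agree off the position `(k, j₀)` are told apart only by the
amplitude with which that position is queried. -/
theorem norm_state_sub_le (X Y : Bool → Matrix (Fin n) (Fin n) G) (j₀ k : Fin n)
    (hXY : ∀ b i j, ¬(i = k ∧ j = j₀) → X b i j = Y b i j)
    (ψ : EuclideanSpace ℂ (Fin n)) (t : ℕ) :
    ‖alg.state X ψ t - alg.state Y ψ t‖ ≤
      ∑ s ∈ Finset.range t, 2 * Real.sqrt (mass (alg.rowSet j₀ k) (alg.state Y ψ s)) := by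
  induction t with
  | zero => simp [state]
  | succ t ih =>
    rw [Finset.sum_range_succ]
    have h := norm_permUnitary_sub_le
      (oraclePerm X : alg.Basis ≃ alg.Basis) (oraclePerm Y) (alg.rowSet j₀ k)
      (fun x => Iff.rfl) (fun x => Iff.rfl)
      (by
        rintro ⟨⟨b, s, i, j, z⟩, r⟩ hx
        simp [oraclePerm, hXY b i j hx])
      (alg.state Y ψ t)
    simp only [state]
    rw [← map_sub, LinearIsometryEquiv.norm_map]
    -- Unitarity carries the old error over unchanged; the new error involves only the run on `Y`.
    calc ‖oracle X (alg.state X ψ t) - oracle Y (alg.state Y ψ t)‖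
        = ‖oracle X (alg.state X ψ t - alg.state Y ψ t) +
            (oracle X (alg.state Y ψ t) - oracle Y (alg.state Y ψ t))‖ := by
          rw [map_sub]; congr 1; abel
      _ ≤ _ := (norm_add_le _ _).trans (add_le_add (((oracle X).norm_map _).trans_le ih) h)

/-- Some row is queried with small total amplitude. -/
theorem exists_row_sum_sqrt_mass_le (hn : 0 < n) (Y : Bool → Matrix (Fin n) (Fin n) G)
    (ψ : EuclideanSpace ℂ (Fin n)) (hψ : ‖alg.init ψ‖ = 1) (j₀ : Fin n) (T : ℕ) :
    ∃ k, (∑ s ∈ Finset.range T, Real.sqrt (mass (alg.rowSet j₀ k) (alg.state Y ψ s))) ^ 2 ≤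
      (T : ℝ) ^ 2 / n := by
  have hn' : (0 : ℝ) < n := by exact_mod_cast hn
  -- The rows are disjoint, so each query contributes total mass at most 1; average over the `n`
  -- rows.
  have htot : ∑ k, ∑ s ∈ Finset.range T, mass (alg.rowSet j₀ k) (alg.state Y ψ s) ≤
      ∑ _k : Fin n, (T : ℝ) / n := by
    rw [Finset.sum_comm]
    calc _ ≤ ∑ _s ∈ Finset.range T, (1 : ℝ) := Finset.sum_le_sum fun s _ => by
          have := sum_mass_le _ (alg.pairwise_disjoint_rowSet j₀) (alg.state Y ψ s)
          simpa [norm_state, hψ] using this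
      _ = _ := by simp [mul_div_cancel₀ _ hn'.ne']
  obtain ⟨k, -, hk⟩ := Finset.exists_le_of_sum_le ⟨⟨0, hn⟩, Finset.mem_univ _⟩ htot
  refine ⟨k, ?_⟩
  calc _ ≤ ((Finset.range T).card : ℝ) * ∑ s ∈ Finset.range T,
        Real.sqrt (mass (alg.rowSet j₀ k) (alg.state Y ψ s)) ^ 2 := sq_sum_le_card_mul_sum_sq
    _ = T * ∑ s ∈ Finset.range T, mass (alg.rowSet j₀ k) (alg.state Y ψ s) := by
        simp [Real.sq_sqrt (mass_nonneg _ _)]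
    _ ≤ T * (T / n) := by gcongr
    _ = _ := by ring

theorem outputProb_eq_mass (X : Bool → Matrix (Fin n) (Fin n) G) (ψ : EuclideanSpace ℂ (Fin n))
    (S : Set ℂ) : alg.outputProb X ψ S = mass (alg.out ⁻¹' S) (alg.state X ψ alg.queries) := rfl

/-- Final states that yield disjoint output sets with probability `2/3` each are far apart. -/
theorem le_norm_state_sub_sq (X X' : Bool → Matrix (Fin n) (Fin n) G)
    (ψ : EuclideanSpace ℂ (Fin n)) (hψ : ‖alg.init ψ‖ = 1) {S S' : Set ℂ} (hS : Disjoint S S')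
    (h : 2 / 3 ≤ alg.outputProb X ψ S) (h' : 2 / 3 ≤ alg.outputProb X' ψ S') :
    1 / 18 ≤ ‖alg.state X ψ alg.queries - alg.state X' ψ alg.queries‖ ^ 2 := by
  rw [outputProb_eq_mass] at h h'
  have h₁ := mass_add_mass_le (hS.preimage alg.out) (alg.state X' ψ alg.queries)
  rw [norm_state, hψ] at h₁
  have h₂ := mass_le_of_sub (alg.out ⁻¹' S) (alg.state X ψ alg.queries)
    (alg.state X' ψ alg.queries)
  -- `2/3 ≤ 3/2 · 1/3 + 3d²` gives `d² ≥ 1/18`.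
  linarith

end QueryAlgorithm

/-- The input whose matrices vanish except that at position `(k, j₀)` the first matrix has the
entry `a` and the second one the entry `g₁`; here `g₀` represents the number `0`. -/
def hiddenEntry {n : ℕ} {G : Type u} (g₀ g₁ a : G) (j₀ k : Fin n) :
    Bool → Matrix (Fin n) (Fin n) G :=
  fun b => Matrix.of fun i j => if i = k ∧ j = j₀ then cond b g₁ a else g₀

theorem hiddenEntry_mulVec {n : ℕ} {G : Type u} {val : G → ℂ} {g₀ : G} (h₀ : val g₀ = 0)
    (g₁ a : G) (j₀ k : Fin n) (b : Bool) :
    (hiddenEntry g₀ g₁ a j₀ k b).map val *ᵥ (EuclideanSpace.single j₀ (1 : ℂ)).ofLp =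
      Pi.single k (val (cond b g₁ a)) := by
  ext i
  by_cases hi : i = k
  · subst hi; simp [hiddenEntry]
  · simp [hiddenEntry, hi, h₀]

theorem det_hiddenEntry {n : ℕ} {G : Type u} {val : G → ℂ} {g₀ : G} (h₀ : val g₀ = 0)
    (g₁ a : G) (j₀ k : Fin n) {j₁ : Fin n} (hj : j₁ ≠ j₀) (b : Bool) :
    ((hiddenEntry g₀ g₁ a j₀ k b).map val).det = 0 :=
  Matrix.det_eq_zero_of_column_eq_zero j₁ fun i => by simp [hiddenEntry, hj, h₀]

/-- A successful algorithm outputs the represented hidden entry, up to the error `ε`. -/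
theorem QueryAlgorithm.FindsEigenvalue.outputProb_hiddenEntry {n : ℕ} {G : Type u}
    [AddCommGroup G] {alg : QueryAlgorithm.{u, v} n G} {val : G → ℂ} {j₀ : Fin n} {ε : ℝ}
    (h : alg.FindsEigenvalue val (EuclideanSpace.single j₀ 1) ε) {g₀ g₁ : G} (h₀ : val g₀ = 0)
    (h₁ : val g₁ = 1) (a : G) (k : Fin n) {j₁ : Fin n} (hj : j₁ ≠ j₀) :
    2 / 3 ≤ alg.outputProb (hiddenEntry g₀ g₁ a j₀ k) (EuclideanSpace.single j₀ 1)
      (Metric.closedBall (val a) ε) := by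
  -- The entry `1` of `B` makes the eigenvalue unique.
  have hμ : ∀ μ : ℂ, (Pi.single k (val a) : Fin n → ℂ) = μ • Pi.single k 1 ↔ μ = val a := by
    intro μ
    rw [← Pi.single_smul, smul_eq_mul, mul_one, (Pi.single_injective k).eq_iff, eq_comm]
  have := h (hiddenEntry g₀ g₁ a j₀ k) _ _ rfl rfl (det_hiddenEntry h₀ g₁ a j₀ k hj true)
  simp only [hiddenEntry_mulVec h₀, cond_false, cond_true, h₁, hμ, exists_eq,
    exists_eq_left, forall_const] at this
  simpa only [Metric.closedBall, dist_eq_norm] using this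

end SingularGEP

open SingularGEP in
theorem mainTheorem3 :
    ∃ c : ℝ, 0 < c ∧ ∀ n : ℕ, 2 ≤ n →
      ∃ ψ : EuclideanSpace ℂ (Fin n), ‖ψ‖ = 1 ∧
        ∀ (G : Type u) [AddCommGroup G] (val : G → ℂ),
          0 ∈ Set.range val → 1 ∈ Set.range val →
          ∀ ε : ℝ, 0 ≤ ε → ε < 1 / 2 →
          ∀ alg : SingularGEP.QueryAlgorithm.{u, v} n G,
            alg.FindsEigenvalue val ψ ε → c * Real.sqrt n ≤ alg.queries := by
  -- The final bound is `n ≤ 288 T²`, and `288 < 17²`.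
  refine ⟨1 / 17, by norm_num, fun n hn => ?_⟩
  let j₀ : Fin n := ⟨0, by omega⟩
  let j₁ : Fin n := ⟨1, by omega⟩
  have hj : j₁ ≠ j₀ := by simp [j₀, j₁]
  refine ⟨EuclideanSpace.single j₀ 1, by simp, ?_⟩
  rintro G _ val ⟨g₀, h₀⟩ ⟨g₁, h₁⟩ ε - hε alg halg
  have hinit := alg.norm_init_single j₀
  -- The row `k` is chosen from the run on the zero input, so it serves both values of the hidden
  -- entry.
  let Y : Bool → Matrix (Fin n) (Fin n) G := fun _ => Matrix.of fun _ _ => g₀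
  obtain ⟨k, hk⟩ :=
    alg.exists_row_sum_sqrt_mass_le (by omega) Y _ hinit j₀ alg.queries
  have hdisj : Disjoint (Metric.closedBall (val g₀) ε) (Metric.closedBall (val g₁) ε) := by
    apply Metric.closedBall_disjoint_closedBall
    rw [h₀, h₁, dist_zero_left, norm_one]
    linarith
  have hfar := alg.le_norm_state_sub_sq _ _ _ hinit hdisj
    (halg.outputProb_hiddenEntry h₀ h₁ g₀ k hj) (halg.outputProb_hiddenEntry h₀ h₁ g₁ k hj)
  have hnear (a : G) := alg.norm_state_sub_le (hiddenEntry g₀ g₁ a j₀ k) Y j₀ k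
    (fun b i j hij => by simp [hiddenEntry, Y, hij]) (EuclideanSpace.single j₀ 1) alg.queries
  simp only [← Finset.mul_sum] at hnear
  set σ := ∑ s ∈ Finset.range alg.queries, Real.sqrt
    (mass (alg.rowSet j₀ k) (alg.state Y (EuclideanSpace.single j₀ 1) s))
  have hclose := (norm_sub_le_norm_sub_add_norm_sub _
    (alg.state Y (EuclideanSpace.single j₀ 1) alg.queries) _).trans
    (add_le_add (hnear g₀) ((norm_sub_rev _ _).trans_le (hnear g₁)))
  have hσ : 1 / 18 ≤ 16 * ((alg.queries : ℝ) ^ 2 / n) := by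
    nlinarith [pow_le_pow_left₀ (norm_nonneg _) hclose 2]
  have hn' : (0 : ℝ) < n := by exact_mod_cast (by omega : 0 < n)
  rw [← mul_div_assoc, le_div_iff₀ hn'] at hσ
  refine (pow_le_pow_iff_left₀ (by positivity) (by positivity) two_ne_zero).1 ?_
  rw [mul_pow, Real.sq_sqrt hn'.le]
  linarith
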